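/- Let $\mathbb{K}$ be a field, $X=\{x_1,\dots,x_n\}$, $U=\{u_1,\dots,u_r\}$, $F\subseteq\mathbb{K}[X][U]$ a finite set and $\mathfrak{I}=\langle F\rangle$. Let $\sigma\in\mathbb{R}^{n+r}_{\ge 0}$ and $\tau=(0,\gamma)$ with $\gamma\in\mathbb{R}^r_{>0}$ (no further condition on the segment $\overline{\sigma\tau}$ is needed; in particular it may be generic). Let $\prec_\sigma,\prec_\tau$ be monomial orders refining $\sigma$ and $\tau$, i.e. $\deg_\sigma(m_1)<\deg_\sigma(m_2)$ implies $m_1\prec_\sigma m_2$, and likewise for $\tau$. Notation: $\underline{GB}(\mathfrak{J},\prec)$ is the reduced Gröbner basis with leading coefficients $1$ of an ideal $\mathfrak{J}$. An order $\prec$ is an $\mathfrak{I}$-specific elimination order ($\mathfrak{I}$-EO) if every $g\in\underline{GB}(\mathfrak{I},\prec)$ with leading term in $\mathbb{K}[X]$ lies in $\mathbb{K}[X]$. The Gröbner cone $C_\prec(\mathfrak{I})$ is the closure of the set of $\omega\in\mathbb{R}^{n+r}_{\ge0}$ for which the initial forms $\mathrm{lt}_\omega(f)$ (sum of the terms of maximal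 $\omega$-degree), $f\in\mathfrak{I}$, generate the same ideal as the leading terms $\mathrm{lt}_\prec(f)$, $f\in\mathfrak{I}$. The order $(\omega|\prec)$ compares $\omega$-degrees first and breaks ties by $\prec$. Algorithm. Start with $k=0$, $\omega_0=\sigma$, $\prec_0=\prec_\sigma$, $G_0=\underline{GB}(\mathfrak{I},\prec_\sigma)$. Step 1: if $\prec_k$ is an $\mathfrak{I}$-EO, return $G_k\cap\mathbb{K}[X]$. Step 2: increase $k$ by $1$; choose $\omega_k$ with $\overline{\omega_{k-1}\omega_k}=\overline{\omega_{k-1}\tau}\cap C_{\prec_{k-1}}(\mathfrak{I})$; put $\prec_k=(\omega_k|\prec_\tau)$; convert $G_{k-1}$ (by any method) into a finite Gröbner basis of $\langle G_{k-1}\rangle$ with respect to $\prec_k$, and interreduce the result to the reduced Gröbner basis $G_k$. Return to Step 1. Theorem. The algorithm terminates and is correct: the initialisation succeeds; whenever Step 1 does not return, Step 2 can be carried out; and no execution runs forever, that is, after finitely many steps $\prec_k$ is an $\mathfrak{I}$-EO and the algorithm returns. Throughout, $\omega_k\in\overline{\sigma\tau}$ and $G_k=\underline{GB}(\mathfrak{I},\prec_k)$.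 On termination, $G_k\cap\mathbb{K}[X]$ is the reduced Gröbner basis of the elimination ideal $\mathfrak{I}\cap\mathbb{K}[X]$ with respect to the restriction of $\prec_k$, an $\mathfrak{I}$-EO, to the monomials in $X$. -/

import Mathlib

universe u v

namespace GroebnerWalk

open MvPolynomial

/-! ### Monomial orders and weight vectors -/

/-- The monomial order obtained by pulling the order of a linearly ordered additive monoid `M` back
along an injective monotone additive map from the exponents to `M`. -/
noncomputable def orderOfHom {ι : Type} [Finite ι] {M : Type v} [AddCommMonoid M] [LinearOrder M]
    [IsOrderedAddMonoid M] (f : (ι →₀ ℕ) →+ M) (hf : Function.Injective f) (hm : Monotone f) :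
    MonomialOrder.{0, v} ι where
  syn := AddMonoidHom.mrange f
  addCommMonoidSyn := inferInstance
  linearOrderSyn := inferInstance
  isOrderedAddMonoid_syn := inferInstance
  toSyn :=
    { Equiv.ofBijective f.mrangeRestrict
        ⟨fun _ _ h => hf (congrArg Subtype.val h), f.mrangeRestrict_surjective⟩ with
      map_add' := fun α β => Subtype.ext (f.map_add α β) }
  toSyn_monotone := fun _ _ h => hm h
  wellFoundedLT_syn := by
    have hmono : Monotone f.mrangeRestrict := fun _ _ h => hm h
    have := hmono.wellQuasiOrderedLE_of_wellQuasiOrderedLE_of_surjective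
      f.mrangeRestrict_surjective
    infer_instance

theorem orderOfHom_lt_iff {ι : Type} [Finite ι] {M : Type v} [AddCommMonoid M] [LinearOrder M]
    [IsOrderedAddMonoid M] (f : (ι →₀ ℕ) →+ M) (hf : Function.Injective f) (hm : Monotone f)
    (α β : ι →₀ ℕ) :
    (orderOfHom f hf hm).toSyn α < (orderOfHom f hf hm).toSyn β ↔ f α < f β :=
  Iff.rfl

/-- The `ω`-degree `ωᵀα` of the monomial with exponent `α`, as an additive map in `α`. -/
noncomputable def wdeg {ι : Type} (ω : ι → ℝ) : (ι →₀ ℕ) →+ ℝ := Finsupp.weight ω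

theorem wdeg_apply {ι : Type} [Fintype ι] (ω : ι → ℝ) (α : ι →₀ ℕ) :
    wdeg ω α = ∑ i, ω i * (α i : ℝ) := by
  simp [wdeg, Finsupp.weight_apply, Finsupp.sum_fintype, mul_comm]

theorem wdeg_mono {ι : Type} {ω : ι → ℝ} (hω : 0 ≤ ω) : Monotone (wdeg ω) := by
  intro a b hab
  obtain ⟨c, rfl⟩ := exists_add_of_le hab
  rw [map_add]
  have hc : 0 ≤ wdeg ω c := by
    rw [wdeg, Finsupp.weight_apply]
    exact Finset.sum_nonneg fun i _ => nsmul_nonneg (hω i) _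
  linarith

/-- The map `y^α ↦ (ωᵀα, α)`, with values in a lexicographic product. -/
noncomputable def weightHom {ι : Type} (ω : ι → ℝ) (m : MonomialOrder.{0, v} ι) :
    (ι →₀ ℕ) →+ ℝ ×ₗ m.syn where
  toFun α := toLex (wdeg ω α, m.toSyn α)
  map_zero' := by rw [map_zero, map_zero]; rfl
  map_add' α β := by rw [map_add, map_add]; rfl

theorem weightHom_injective {ι : Type} (ω : ι → ℝ) (m : MonomialOrder.{0, v} ι) :
    Function.Injective (weightHom ω m) :=
  fun _ _ h => m.toSyn.injective (congrArg (fun p => (ofLex p).2) h)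

theorem weightHom_monotone {ι : Type} {ω : ι → ℝ} (hω : 0 ≤ ω) (m : MonomialOrder.{0, v} ι) :
    Monotone (weightHom ω m) :=
  fun _ _ h => Prod.Lex.toLex_mono (Prod.mk_le_mk.2 ⟨wdeg_mono hω h, m.toSyn_monotone h⟩)

/-- The order `(ω | ≺)`: compare `ω`-degrees first and break ties with `≺`
(see `weightOrder_lt_iff`). -/
noncomputable def weightOrder {ι : Type} [Finite ι] (ω : ι → ℝ) (hω : 0 ≤ ω)
    (m : MonomialOrder.{0, v} ι) : MonomialOrder.{0, v} ι :=
  orderOfHom (weightHom ω m) (weightHom_injective ω m) (weightHom_monotone hω m)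

theorem weightOrder_lt_iff {ι : Type} [Finite ι] (ω : ι → ℝ) (hω : 0 ≤ ω)
    (m : MonomialOrder.{0, v} ι) (α β : ι →₀ ℕ) :
    (weightOrder ω hω m).toSyn α < (weightOrder ω hω m).toSyn β ↔
      wdeg ω α < wdeg ω β ∨ (wdeg ω α = wdeg ω β ∧ m.toSyn α < m.toSyn β) :=
  (orderOfHom_lt_iff _ _ _ α β).trans Prod.Lex.toLex_lt_toLex

/-- `≺` refines the weight vector `ω`: whenever `deg_ω y^α < deg_ω y^β`, then `y^α ≺ y^β`. -/
def Refines {ι : Type} (m : MonomialOrder.{0, v} ι) (ω : ι → ℝ) : Prop :=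
  ∀ α β : ι →₀ ℕ, wdeg ω α < wdeg ω β → m.toSyn α < m.toSyn β

/-! ### Initial ideals, Gröbner cones, Gröbner bases -/

/-- The ideal generated by the leading terms of the elements of `S`. -/
noncomputable def leadIdeal {ι : Type} {K : Type u} [Field K] (m : MonomialOrder.{0, v} ι)
    (S : Set (MvPolynomial ι K)) : Ideal (MvPolynomial ι K) :=
  Ideal.span (m.leadingTerm '' S)

open Classical in
/-- The initial form of `f` with respect to `ω`: the sum of the terms of `f` of maximal
`ω`-degree. -/
noncomputable def initialForm {ι : Type} {K : Type u} [Field K] (ω : ι → ℝ)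
    (f : MvPolynomial ι K) : MvPolynomial ι K :=
  ∑ α ∈ f.support.filter (fun α => ∀ β ∈ f.support, wdeg ω β ≤ wdeg ω α),
    monomial α (f.coeff α)

/-- The initial ideal of `I` with respect to `ω`. -/
noncomputable def initialIdeal {ι : Type} {K : Type u} [Field K] (ω : ι → ℝ)
    (I : Ideal (MvPolynomial ι K)) : Ideal (MvPolynomial ι K) :=
  Ideal.span (initialForm ω '' (I : Set (MvPolynomial ι K)))

/-- The Gröbner cone of `I` with respect to `≺`. -/
def groebnerCone {ι : Type} {K : Type u} [Field K] (m : MonomialOrder.{0, v} ι)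
    (I : Ideal (MvPolynomial ι K)) : Set (ι → ℝ) :=
  closure {ω | 0 ≤ ω ∧ initialIdeal ω I = leadIdeal m (I : Set (MvPolynomial ι K))}

/-- `G` is a (finite) Gröbner basis of `I` with respect to `≺`. -/
structure IsGroebnerBasis {ι : Type} {K : Type u} [Field K] (m : MonomialOrder.{0, v} ι)
    (I : Ideal (MvPolynomial ι K)) (G : Set (MvPolynomial ι K)) : Prop where
  finite : G.Finite
  subset : G ⊆ (I : Set (MvPolynomial ι K))
  leadIdeal_eq : leadIdeal m G = leadIdeal m (I : Set (MvPolynomial ι K))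

/-- `G` is the normed reduced Gröbner basis of `I` with respect to `≺`: all leading coefficients
are `1`, and for distinct `g, h ∈ G` the leading monomial of `g` divides no monomial of `h`. -/
structure IsReducedGroebnerBasis {ι : Type} {K : Type u} [Field K] (m : MonomialOrder.{0, v} ι)
    (I : Ideal (MvPolynomial ι K)) (G : Set (MvPolynomial ι K)) : Prop
    extends IsGroebnerBasis m I G where
  normed : ∀ g ∈ G, m.Monic g
  reduced : ∀ g ∈ G, ∀ h ∈ G, g ≠ h → ∀ α ∈ h.support, ¬ m.degree g ≤ α

/-! ### Elimination: the variables are `x_1, …, x_n` (left summand) and `u_1, …, u_r`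
(right summand) -/

/-- The embedding `K[X] → K[X][U]`. -/
noncomputable def embX (K : Type u) [Field K] (n r : ℕ) :
    MvPolynomial (Fin n) K →ₐ[K] MvPolynomial (Fin n ⊕ Fin r) K :=
  rename Sum.inl

/-- `≺` is an `I`-specific elimination order for `U`: every element of the reduced Gröbner basis
of `I` whose leading term lies in `K[X]` lies itself in `K[X]`. -/
def IsElimOrder {K : Type u} [Field K] {n r : ℕ} (m : MonomialOrder.{0, v} (Fin n ⊕ Fin r))
    (I : Ideal (MvPolynomial (Fin n ⊕ Fin r) K)) : Prop :=
  ∃ G, IsReducedGroebnerBasis m I G ∧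
    ∀ g ∈ G, m.leadingTerm g ∈ (embX K n r).range → g ∈ (embX K n r).range

/-- The elimination ideal `I ∩ K[X]`, as an ideal of `K[X]`. -/
noncomputable def elimIdeal {K : Type u} [Field K] {n r : ℕ}
    (I : Ideal (MvPolynomial (Fin n ⊕ Fin r) K)) : Ideal (MvPolynomial (Fin n) K) :=
  I.comap (embX K n r)

/-- The set `G ∩ K[X]`, as a subset of `K[X]`. -/
def elimPart {K : Type u} [Field K] {n r : ℕ} (G : Set (MvPolynomial (Fin n ⊕ Fin r) K)) :
    Set (MvPolynomial (Fin n) K) :=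
  embX K n r ⁻¹' G

/-- The map `x^α ↦ x^α`, from monomials in `X` into the value monoid of `≺`. -/
noncomputable def restrictHom {n r : ℕ} (m : MonomialOrder.{0, v} (Fin n ⊕ Fin r)) :
    (Fin n →₀ ℕ) →+ m.syn where
  toFun α := m.toSyn (α.mapDomain Sum.inl)
  map_zero' := by rw [Finsupp.mapDomain_zero, map_zero]
  map_add' α β := by rw [Finsupp.mapDomain_add, map_add]

theorem restrictHom_injective {n r : ℕ} (m : MonomialOrder.{0, v} (Fin n ⊕ Fin r)) :
    Function.Injective (restrictHom m) :=
  fun _ _ h => Finsupp.mapDomain_injective Sum.inl_injective (m.toSyn.injective h)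

theorem restrictHom_monotone {n r : ℕ} (m : MonomialOrder.{0, v} (Fin n ⊕ Fin r)) :
    Monotone (restrictHom m) :=
  fun _ _ h => m.toSyn_monotone (Finsupp.mapDomain_mono h)

/-- The restriction of a monomial order to the monomials in `X` (see `restrictX_lt_iff`). -/
noncomputable def restrictX {n r : ℕ} (m : MonomialOrder.{0, v} (Fin n ⊕ Fin r)) :
    MonomialOrder.{0, v} (Fin n) :=
  orderOfHom (restrictHom m) (restrictHom_injective m) (restrictHom_monotone m)

theorem restrictX_lt_iff {n r : ℕ} (m : MonomialOrder.{0, v} (Fin n ⊕ Fin r))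
    (α β : Fin n →₀ ℕ) :
    (restrictX m).toSyn α < (restrictX m).toSyn β ↔
      m.toSyn (α.mapDomain Sum.inl) < m.toSyn (β.mapDomain Sum.inl) :=
  orderOfHom_lt_iff _ _ _ α β

/-! ### The improved elimination algorithm, as a transition system -/

/-- A state of the algorithm: the values of `k`, `ω_k ∈ ℝ_{≥0}^{n+r}`, `≺_k` and `G_k` when the loop
is entered. -/
structure State (K : Type u) [Field K] (n r : ℕ) where
  k : ℕ
  ω : Fin n ⊕ Fin r → ℝ
  ω_nonneg : 0 ≤ ω
  order : MonomialOrder.{0, v} (Fin n ⊕ Fin r)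
  G : Set (MvPolynomial (Fin n ⊕ Fin r) K)

/-- The result of the initialisation: `k = 0`, `ω_0 = σ`, `≺_0 = ≺_σ` and `G_0` is the reduced
Gröbner basis of `I` with respect to `≺_σ`. -/
structure IsInit {K : Type u} [Field K] {n r : ℕ} (I : Ideal (MvPolynomial (Fin n ⊕ Fin r) K))
    (σ : Fin n ⊕ Fin r → ℝ) (ordσ : MonomialOrder.{0, v} (Fin n ⊕ Fin r))
    (s : State.{u, v} K n r) : Prop where
  k_eq : s.k = 0
  ω_eq : s.ω = σ
  order_eq : s.order = ordσ
  basis : IsReducedGroebnerBasis ordσ I s.G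

/-- The termination test returns in the state `s` exactly if the current order is an `I`-specific elimination
order; the returned set is then `elimPart s.G`. -/
def Halts {K : Type u} [Field K] {n r : ℕ} (I : Ideal (MvPolynomial (Fin n ⊕ Fin r) K))
    (s : State.{u, v} K n r) : Prop :=
  IsElimOrder s.order I

/-- One pass through the loop, from `s` to `t`. The termination test fails in `s`; `k` is increased;
the next weight vector is the end of the part of the segment from `s.ω` to `τ` that lies in the
current Gröbner cone; the new order is `(ω_k | ≺_τ)`; the old basis is converted into some Gröbner
basis `H`, of the ideal that it generates, with respect to the new order; and `H` is interreduced.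
The step is a relation because the method of conversion, and with it `H`, is left open. -/
structure Step {K : Type u} [Field K] {n r : ℕ} (I : Ideal (MvPolynomial (Fin n ⊕ Fin r) K))
    (τ : Fin n ⊕ Fin r → ℝ) (ordτ : MonomialOrder.{0, v} (Fin n ⊕ Fin r))
    (s t : State.{u, v} K n r) : Prop where
  not_halts : ¬ Halts I s
  k_eq : t.k = s.k + 1
  segment_eq : segment ℝ s.ω t.ω = segment ℝ s.ω τ ∩ groebnerCone s.order I
  order_eq : t.order = weightOrder t.ω t.ω_nonneg ordτ
  basis : ∃ H, IsGroebnerBasis t.order (Ideal.span s.G) H ∧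
    IsReducedGroebnerBasis t.order (Ideal.span H) t.G

/-- `s` occurs in some execution of the algorithm. -/
def Reachable {K : Type u} [Field K] {n r : ℕ} (I : Ideal (MvPolynomial (Fin n ⊕ Fin r) K))
    (σ τ : Fin n ⊕ Fin r → ℝ) (ordσ ordτ : MonomialOrder.{0, v} (Fin n ⊕ Fin r))
    (s : State.{u, v} K n r) : Prop :=
  ∃ s₀, IsInit I σ ordσ s₀ ∧ Relation.ReflTransGen (Step I τ ordτ) s₀ s

end GroebnerWalk

/-!
# Termination and correctness of the elimination walk

Why the loop cannot get stuck. For the reduced Gröbner basis `G` of `I` with respect to `≺`, a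
weight vector `ω ≥ 0` satisfies `in_ω(I) = in_≺(I)` exactly if in each `g ∈ G` the leading monomial
is the only one of maximal `ω`-degree (`IsReducedGroebnerBasis.setOf_initialIdeal_eq`). So the
Gröbner cone is convex and closed, and the part of a segment starting in it that lies in it is again
a segment. The starting point does lie in it: the cone also contains the `ω` for which the leading
monomials are only weakly maximal (`IsReducedGroebnerBasis.mem_groebnerCone`), and `≺_k` refines
`ω_k`. This needs some `ω₀ ≥ 0` for which they are strictly maximal; such an `ω₀` is found by
Fourier–Motzkin elimination (`exists_wdeg_lt_of_agree_off`).

Why the loop ends (`exists_walk_eq_target`). As `≺_τ` refines `τ`, the cone of `(ω | ≺_τ)` contains an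
initial part of the segment from `ω` to `τ`, so from `k = 1` on every pass makes progress until
`τ` is reached, and there the order is an elimination order. In an infinite run the `ω_k` would
converge, without reaching it, to some `ω' = u'σ' + (1 - u')τ` with `σ' = ω_1`. On a finite set of
comparisons, the orders `(ω_k | ≺_τ)` eventually agree with `(ω' | (σ' | ≺_τ))`. Applied to the
reduced Gröbner basis of the latter order, this shows that the leading ideals for all late `≺_k`
agree. The Gröbner cone depends on the leading ideal only, so two consecutive steps go
through one and the same cone, although the first of them was as long as the cone permits. The
finiteness of the set of all initial ideals of `I` is not needed.

The output is correct because divisors of monomials in `X` are monomials in `X`: if the leading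
monomial of `f ∈ I ∩ K[X]` is divisible by that of `g ∈ G`, then `g ∈ K[X]` by the elimination
property (`IsReducedGroebnerBasis.elimPart`).
-/

namespace GroebnerWalk

open MvPolynomial

open scoped MonomialOrder

/-! ### Leading ideals and division by Gröbner bases -/

section Groebner

variable {ι : Type} {K : Type u} [Field K] {m : MonomialOrder.{0, v} ι}
  {I : Ideal (MvPolynomial ι K)} {G : Set (MvPolynomial ι K)}

/-- Membership in a leading ideal is a condition on each monomial. The zero polynomial has to be
excluded on the right: its `degree` is `0`, but its leading term is `0`. -/
theorem mem_leadIdeal_iff {S : Set (MvPolynomial ι K)} {p : MvPolynomial ι K} :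
    p ∈ leadIdeal m S ↔ ∀ α ∈ p.support, ∃ s ∈ S, s ≠ 0 ∧ m.degree s ≤ α := by
  have key : leadIdeal m S =
      Ideal.span ((fun α => monomial α (1 : K)) '' (m.degree '' {s ∈ S | s ≠ 0})) := by
    apply le_antisymm
    · refine Ideal.span_le.2 ?_
      rintro _ ⟨s, hs, rfl⟩
      by_cases h0 : s = 0
      · simp [h0]
      rw [SetLike.mem_coe, ← m.C_mul_leadingCoeff_monomial_degree]
      exact Ideal.mul_mem_left _ _ (Ideal.subset_span ⟨_, ⟨s, ⟨hs, h0⟩, rfl⟩, rfl⟩)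
    · refine Ideal.span_le.2 ?_
      rintro _ ⟨_, ⟨s, ⟨hs, h0⟩, rfl⟩, rfl⟩
      have h : monomial (m.degree s) (1 : K) = C (m.leadingCoeff s)⁻¹ * m.leadingTerm s := by
        rw [MonomialOrder.leadingTerm, C_mul_monomial,
          inv_mul_cancel₀ (m.leadingCoeff_ne_zero_iff.2 h0)]
      simp only [SetLike.mem_coe, h]
      exact Ideal.mul_mem_left _ _ (Ideal.subset_span ⟨s, hs, rfl⟩)
  rw [key, mem_ideal_span_monomial_image]
  simp only [Set.exists_mem_image, Set.mem_ofPred_eq, and_assoc]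

theorem leadIdeal_mono {S T : Set (MvPolynomial ι K)} (h : S ⊆ T) :
    leadIdeal m S ≤ leadIdeal m T :=
  Ideal.span_mono (Set.image_mono h)

theorem leadIdeal_le_iff {S T : Set (MvPolynomial ι K)} :
    leadIdeal m S ≤ leadIdeal m T ↔
      ∀ s ∈ S, s ≠ 0 → ∃ t ∈ T, t ≠ 0 ∧ m.degree t ≤ m.degree s := by
  constructor
  · intro h s hs h0
    refine mem_leadIdeal_iff.1 (h (Ideal.subset_span ⟨s, hs, rfl⟩)) _ ?_
    rw [m.support_leadingTerm' h0, Finset.mem_singleton]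
  · intro h
    refine Ideal.span_le.2 ?_
    rintro _ ⟨s, hs, rfl⟩
    refine mem_leadIdeal_iff.2 fun α hα => ?_
    have h0 : s ≠ 0 := by rintro rfl; simp at hα
    rw [m.support_leadingTerm' h0, Finset.mem_singleton] at hα
    exact hα ▸ h s hs h0

theorem IsGroebnerBasis.exists_degree_le (hG : IsGroebnerBasis m I G) {f : MvPolynomial ι K}
    (hf : f ∈ I) (h0 : f ≠ 0) : ∃ g ∈ G, g ≠ 0 ∧ m.degree g ≤ m.degree f :=
  leadIdeal_le_iff.1 hG.leadIdeal_eq.ge f hf h0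

theorem IsGroebnerBasis.sdiff_zero (hG : IsGroebnerBasis m I G) :
    IsGroebnerBasis m I (G \ {0}) where
  finite := hG.finite.subset Set.sdiff_subset
  subset := Set.sdiff_subset.trans hG.subset
  leadIdeal_eq := by
    rw [← hG.leadIdeal_eq]
    refine le_antisymm (leadIdeal_mono Set.sdiff_subset) (leadIdeal_le_iff.2 fun s hs h0 => ?_)
    exact ⟨s, ⟨hs, h0⟩, h0, le_rfl⟩

theorem IsReducedGroebnerBasis.ne_zero (hG : IsReducedGroebnerBasis m I G) {g : MvPolynomial ι K}
    (hg : g ∈ G) : g ≠ 0 :=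
  (hG.normed g hg).ne_zero

/-- Division by a Gröbner basis for `≺` of an element of the ideal leaves no remainder, also if
the division follows another order `≺'`, provided that both orders select the same leading
monomials in the basis. -/
theorem IsGroebnerBasis.exists_representation (hG : IsGroebnerBasis m I G)
    (hG0 : ∀ g ∈ G, g ≠ 0) {m' : MonomialOrder.{0, v} ι}
    (hdeg : ∀ g ∈ G, m'.degree g = m.degree g) {f : MvPolynomial ι K} (hf : f ∈ I) :
    ∃ q : G →₀ MvPolynomial ι K,
      f = q.sum (fun b c => c * (b : MvPolynomial ι K)) ∧
        ∀ b : G, m'.degree ((b : MvPolynomial ι K) * q b) ≼[m'] m'.degree f := by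
  obtain ⟨q, r, hfr, hq, hr⟩ := m'.div_set (B := G)
    (fun b hb => isUnit_iff_ne_zero.2 (m'.leadingCoeff_ne_zero_iff.2 (hG0 b hb))) f
  refine ⟨q, ?_, hq⟩
  have hsum : Finsupp.linearCombination (MvPolynomial ι K) (fun b : G => (b : MvPolynomial ι K)) q
      ∈ I := by
    rw [Finsupp.linearCombination_apply]
    exact Ideal.sum_mem _ fun b _ => Ideal.mul_mem_left _ _ (hG.subset b.2)
  have hrI : r ∈ I := by
    have : r = f - Finsupp.linearCombination (MvPolynomial ι K)
        (fun b : G => (b : MvPolynomial ι K)) q := by rw [hfr]; ring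
    exact this ▸ I.sub_mem hf hsum
  have hr0 : r = 0 := by
    by_contra h0
    obtain ⟨g, hg, -, hle⟩ := hG.exists_degree_le hrI h0
    exact hr _ (m.degree_mem_support h0) g hg (hdeg g hg ▸ hle)
  rw [hfr, hr0, add_zero, Finsupp.linearCombination_apply]
  rfl

theorem IsGroebnerBasis.span_eq (hG : IsGroebnerBasis m I G) : Ideal.span G = I := by
  refine le_antisymm (Ideal.span_le.2 hG.subset) fun f hf => ?_
  obtain ⟨q, rfl, -⟩ := hG.sdiff_zero.exists_representation (fun g hg => hg.2)
    (fun g _ => rfl) hf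
  exact Ideal.sum_mem _ fun b _ => Ideal.mul_mem_left _ _ (Ideal.subset_span b.2.1)

theorem degree_eq_of_forall_lt {m' : MonomialOrder.{0, v} ι} {g : MvPolynomial ι K} (h0 : g ≠ 0)
    {α : ι →₀ ℕ} (hα : α ∈ g.support) (h : ∀ β ∈ g.support, β ≠ α → m'.toSyn β < m'.toSyn α) :
    m'.degree g = α := by
  by_contra hne
  exact absurd (m'.le_degree hα) (not_le.2 (h _ (m'.degree_mem_support h0) hne))

/-- A Gröbner basis whose leading monomials are not changed by the passage from `≺` to `≺'`
determines the leading ideal for `≺'` too. -/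
theorem IsGroebnerBasis.leadIdeal_eq_of_degree_eq (hG : IsGroebnerBasis m I G)
    (hG0 : ∀ g ∈ G, g ≠ 0) {m' : MonomialOrder.{0, v} ι}
    (hdeg : ∀ g ∈ G, m'.degree g = m.degree g) :
    leadIdeal m' (I : Set (MvPolynomial ι K)) = leadIdeal m (I : Set (MvPolynomial ι K)) := by
  have hlead : leadIdeal m' G = leadIdeal m G := by
    ext p
    simp only [mem_leadIdeal_iff]
    refine forall₂_congr fun α _ => exists_congr fun g => ?_
    refine and_congr_right fun hg => ?_
    rw [hdeg g hg]
  refine le_antisymm ?_ ?_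
  · rw [← hG.leadIdeal_eq, ← hlead]
    refine leadIdeal_le_iff.2 fun f hf h0 => ?_
    obtain ⟨q, hfq, hq⟩ := hG.exists_representation hG0 hdeg hf
    have hmem := m'.degree_mem_support h0
    -- the leading monomial of `f` occurs in some summand, and is the leading monomial there
    have hex : ∃ b : G, m'.degree f ∈ (q b * (b : MvPolynomial ι K)).support := by
      classical
      have h2 : m'.degree f ∈ (q.sum fun b c => c * (b : MvPolynomial ι K)).support := hfq ▸ hmem
      obtain ⟨b, -, hb⟩ := Finset.mem_biUnion.1 (support_sum h2)
      exact ⟨b, hb⟩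
    obtain ⟨b, hb⟩ := hex
    have hdeg' : m'.degree (q b * (b : MvPolynomial ι K)) = m'.degree f :=
      m'.toSyn.injective (le_antisymm (mul_comm (q b) (b : MvPolynomial ι K) ▸ hq b)
        (m'.le_degree hb))
    have hqb : q b ≠ 0 := by rintro h; simp [h] at hb
    refine ⟨b, b.2, hG0 b b.2, ?_⟩
    rw [← hdeg', m'.degree_mul hqb (hG0 b b.2)]
    exact le_add_self
  · rw [← hG.leadIdeal_eq, ← hlead]
    exact leadIdeal_mono hG.subset

/-! ### Existence and uniqueness of reduced Gröbner bases -/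

theorem finite_setOf_minimal [Finite ι] (S : Set (ι →₀ ℕ)) : {α | Minimal (· ∈ S) α}.Finite :=
  WellQuasiOrderedLE.finite_of_isAntichain (setOfPred_minimal_antichain _)

/-- Every ideal has a reduced Gröbner basis: take the minimal monomials of the leading ideal, and
subtract from each of them its normal form. -/
theorem exists_isReducedGroebnerBasis [Finite ι] (m : MonomialOrder.{0, v} ι)
    (I : Ideal (MvPolynomial ι K)) : ∃ G, IsReducedGroebnerBasis m I G := by
  classical
  set L : Set (ι →₀ ℕ) := m.degree '' {f : MvPolynomial ι K | f ∈ I ∧ f ≠ 0} with hL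
  have hex : ∀ α ∈ L, ∃ r : MvPolynomial ι K, monomial α 1 - r ∈ I ∧
      (∀ β ∈ r.support, m.toSyn β < m.toSyn α) ∧ ∀ β ∈ r.support, ∀ δ ∈ L, ¬ δ ≤ β := by
    rintro _ ⟨f, ⟨hf, h0⟩, rfl⟩
    obtain ⟨q, r, hqr, hq, hr⟩ := m.div_set (B := {f : MvPolynomial ι K | f ∈ I ∧ f ≠ 0})
      (fun b hb => isUnit_iff_ne_zero.2 (m.leadingCoeff_ne_zero_iff.2 hb.2))
      (monomial (m.degree f) (1 : K))
    have hr' : ∀ β ∈ r.support, ∀ δ ∈ L, ¬ δ ≤ β := by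
      rintro β hβ _ ⟨g, hg, rfl⟩
      exact hr β hβ g hg
    refine ⟨r, ?_, fun β hβ => ?_, hr'⟩
    · rw [hqr, add_sub_cancel_right, Finsupp.linearCombination_apply]
      exact Ideal.sum_mem _ fun b _ => Ideal.mul_mem_left _ _ b.2.1
    · refine lt_of_le_of_ne ?_ fun h => hr' β hβ _ ⟨f, ⟨hf, h0⟩, rfl⟩ (m.toSyn.injective h).ge
      have hr2 : r = monomial (m.degree f) 1 - q.sum fun b c => c * (b : MvPolynomial ι K) := by
        rw [hqr, Finsupp.linearCombination_apply]; simp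
      have hdr : m.degree (monomial (m.degree f) (1 : K)) = m.degree f := by
        rw [m.degree_monomial, if_neg one_ne_zero]
      rw [hr2] at hβ
      rcases Finset.mem_union.1 (support_sub _ _ _ hβ) with h | h
      · exact hdr ▸ m.le_degree h
      · obtain ⟨b, -, hb⟩ := Finset.mem_biUnion.1 (support_sum h)
        have hb' : β ∈ ((b : MvPolynomial ι K) * q b).support := mul_comm (q b) b.1 ▸ hb
        exact hdr ▸ (m.le_degree hb').trans (hq b)
  choose! r hrI hrlt hrL using hex
  have hcoeff : ∀ α ∈ L, (r α).coeff α = 0 := fun α hα => by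
    by_contra h
    exact lt_irrefl _ (hrlt α hα α (mem_support_iff.2 h))
  have hne : ∀ α ∈ L, monomial α 1 - r α ≠ 0 := fun α hα h => by
    have := congrArg (coeff α) h
    simp [hcoeff α hα] at this
  have hdeg : ∀ α ∈ L, m.degree (monomial α 1 - r α) = α := fun α hα => by
    refine degree_eq_of_forall_lt (hne α hα) (by simp [hcoeff α hα]) fun β hβ hβα => ?_
    refine hrlt α hα β ?_
    rw [mem_support_iff, coeff_sub, coeff_monomial, if_neg (Ne.symm hβα), zero_sub,
      neg_ne_zero] at hβ
    exact mem_support_iff.2 hβ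
  have hsub : (fun α => monomial α 1 - r α) '' {α | Minimal (· ∈ L) α} ⊆
      (I : Set (MvPolynomial ι K)) := by
    rintro _ ⟨α, hα, rfl⟩
    exact hrI α hα.prop
  refine ⟨(fun α => monomial α 1 - r α) '' {α | Minimal (· ∈ L) α}, ⟨⟨?_, hsub, ?_⟩, ?_, ?_⟩⟩
  · exact (finite_setOf_minimal L).image _
  · refine le_antisymm (leadIdeal_mono hsub) (leadIdeal_le_iff.2 fun f hf h0 => ?_)
    obtain ⟨α, hle, hα⟩ := exists_minimal_le_of_wellFoundedLT (· ∈ L) _ ⟨f, ⟨hf, h0⟩, rfl⟩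
    exact ⟨_, ⟨α, hα, rfl⟩, hne α hα.prop, (hdeg α hα.prop).trans_le hle⟩
  · rintro _ ⟨α, hα, rfl⟩
    rw [MonomialOrder.Monic, MonomialOrder.leadingCoeff, hdeg α hα.prop]
    simp [hcoeff α hα.prop]
  · rintro _ ⟨α, hα, rfl⟩ _ ⟨β, hβ, rfl⟩ hαβ δ hδ
    simp only [hdeg α hα.prop]
    intro hle
    rcases Finset.mem_union.1 (support_sub _ _ _ hδ) with h | h
    · have h' := Finset.mem_singleton.1 (support_monomial_subset h)
      subst h'
      exact hαβ (by rw [hβ.eq_of_le hα.prop hle])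
    · exact hrL β hβ.prop δ h α hα.prop hle

/-- In a reduced Gröbner basis, the leading monomial of an element divides no other of its
monomials either, because divisibility is compatible with the order. -/
theorem IsReducedGroebnerBasis.eq_of_degree_le (hG : IsReducedGroebnerBasis m I G)
    {g h : MvPolynomial ι K} (hg : g ∈ G) (hh : h ∈ G) {α : ι →₀ ℕ} (hα : α ∈ h.support)
    (hle : m.degree g ≤ α) : g = h ∧ α = m.degree g := by
  have hgh : g = h := by
    by_contra hne
    exact hG.reduced g hg h hh hne α hα hle
  subst hgh
  exact ⟨rfl, m.toSyn.injective (le_antisymm (m.le_degree hα) (m.toSyn_monotone hle))⟩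

theorem IsReducedGroebnerBasis.subset_of_isReducedGroebnerBasis
    {G' : Set (MvPolynomial ι K)} (hG : IsReducedGroebnerBasis m I G)
    (hG' : IsReducedGroebnerBasis m I G') : G ⊆ G' := by
  classical
  intro g hg
  obtain ⟨h, hh, -, hhg⟩ := hG'.exists_degree_le (hG.subset hg) (hG.ne_zero hg)
  obtain ⟨g', hg', -, hgh⟩ := hG.exists_degree_le (hG'.subset hh) (hG'.ne_zero hh)
  obtain ⟨rfl, -⟩ := hG.eq_of_degree_le hg' hg (m.degree_mem_support (hG.ne_zero hg))
    (hgh.trans hhg)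
  have hdeg : m.degree g' = m.degree h := le_antisymm hgh hhg
  suffices g' - h = 0 from sub_eq_zero.1 this ▸ hh
  by_contra h0
  have hmem := m.degree_mem_support h0
  -- the leading monomials of `g'` and `h` cancel, so the one of the difference is smaller
  have hne : m.degree (g' - h) ≠ m.degree g' := fun he => by
    refine mem_support_iff.1 hmem ?_
    rw [he, coeff_sub, (hG.normed g' hg).coeff_degree, hdeg, (hG'.normed h hh).coeff_degree,
      sub_self]
  rcases Finset.mem_union.1 (support_sub _ _ _ hmem) with hs | hs
  · obtain ⟨k, hk, -, hle⟩ := hG.exists_degree_le (I.sub_mem (hG.subset hg) (hG'.subset hh)) h0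
    obtain ⟨rfl, he⟩ := hG.eq_of_degree_le hk hg hs hle
    exact hne he
  · obtain ⟨k, hk, -, hle⟩ := hG'.exists_degree_le (I.sub_mem (hG.subset hg) (hG'.subset hh)) h0
    obtain ⟨rfl, he⟩ := hG'.eq_of_degree_le hk hh hs hle
    exact hne (he.trans hdeg.symm)

theorem IsReducedGroebnerBasis.unique {G' : Set (MvPolynomial ι K)}
    (hG : IsReducedGroebnerBasis m I G) (hG' : IsReducedGroebnerBasis m I G') : G = G' :=
  (hG.subset_of_isReducedGroebnerBasis hG').antisymm (hG'.subset_of_isReducedGroebnerBasis hG)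

/-! ### Initial ideals with respect to weight vectors -/

open Classical in
theorem coeff_initialForm (ω : ι → ℝ) (f : MvPolynomial ι K) (α : ι →₀ ℕ) :
    (initialForm ω f).coeff α = if ∀ β ∈ f.support, wdeg ω β ≤ wdeg ω α then f.coeff α else 0 := by
  rw [initialForm, coeff_sum]
  simp only [coeff_monomial]
  rw [Finset.sum_ite_eq']
  by_cases h : f.coeff α = 0
  · simp [h]
  · simp [h]

theorem mem_support_initialForm {ω : ι → ℝ} {f : MvPolynomial ι K} {α : ι →₀ ℕ} :
    α ∈ (initialForm ω f).support ↔ α ∈ f.support ∧ ∀ β ∈ f.support, wdeg ω β ≤ wdeg ω α := by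
  classical
  rw [mem_support_iff, coeff_initialForm, ite_ne_right_iff, mem_support_iff, and_comm]

theorem wdeg_le_of_toSyn_le [Finite ι] {ω : ι → ℝ} {hω : 0 ≤ ω} {α β : ι →₀ ℕ}
    (h : (weightOrder ω hω m).toSyn α ≤ (weightOrder ω hω m).toSyn β) : wdeg ω α ≤ wdeg ω β := by
  by_contra! hlt
  exact absurd h (not_le.2 ((weightOrder_lt_iff ω hω m _ _).2 (Or.inl hlt)))

/-- A weight vector for which the leading monomials of a Gröbner basis are strictly maximal among
the monomials of their polynomials defines the same initial ideal as the monomial order. -/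
theorem IsGroebnerBasis.initialIdeal_eq [Finite ι] (hG : IsGroebnerBasis m I G)
    (hG0 : ∀ g ∈ G, g ≠ 0) {ω : ι → ℝ} (hω : 0 ≤ ω)
    (h : ∀ g ∈ G, ∀ β ∈ g.support, β ≠ m.degree g → wdeg ω β < wdeg ω (m.degree g)) :
    initialIdeal ω I = leadIdeal m (I : Set (MvPolynomial ι K)) := by
  classical
  have hle : ∀ g ∈ G, ∀ β ∈ g.support, wdeg ω β ≤ wdeg ω (m.degree g) := fun g hg β hβ => by
    rcases eq_or_ne β (m.degree g) with rfl | hne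
    · exact le_rfl
    · exact (h g hg β hβ hne).le
  have hdeg : ∀ g ∈ G, (weightOrder ω hω m).degree g = m.degree g := fun g hg =>
    degree_eq_of_forall_lt (hG0 g hg) (m.degree_mem_support (hG0 g hg)) fun β hβ hne =>
      (weightOrder_lt_iff ω hω m _ _).2 (Or.inl (h g hg β hβ hne))
  apply le_antisymm
  · refine Ideal.span_le.2 ?_
    rintro _ ⟨f, hf, rfl⟩
    rw [← hG.leadIdeal_eq]
    refine mem_leadIdeal_iff.2 fun α hα => ?_
    obtain ⟨hαf, hmax⟩ := mem_support_initialForm.1 hα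
    obtain ⟨q, hfq, hq⟩ := hG.exists_representation hG0 hdeg hf
    have hex : ∃ b : G, α ∈ (q b * (b : MvPolynomial ι K)).support := by
      have h2 : α ∈ (q.sum fun b c => c * (b : MvPolynomial ι K)).support := hfq ▸ hαf
      obtain ⟨b, -, hb⟩ := Finset.mem_biUnion.1 (support_sum h2)
      exact ⟨b, hb⟩
    obtain ⟨b, hb⟩ := hex
    have hqb : q b ≠ 0 := by rintro h; simp [h] at hb
    obtain ⟨β, hβ, δ, hδ, rfl⟩ := Finset.mem_add.1 (support_mul _ _ hb)
    have h0 : f ≠ 0 := by rintro rfl; simp at hαf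
    have hbound : wdeg ω β + wdeg ω (m.degree (b : MvPolynomial ι K)) ≤ wdeg ω (β + δ) := by
      refine le_trans ?_ (hmax _ ((weightOrder ω hω m).degree_mem_support h0))
      refine le_trans ?_ (wdeg_le_of_toSyn_le (hq b))
      rw [(weightOrder ω hω m).degree_mul (hG0 b b.2) hqb, map_add, hdeg b b.2, add_comm]
      exact add_le_add_right (wdeg_le_of_toSyn_le ((weightOrder ω hω m).le_degree hβ)) _
    -- a summand of maximal `ω`-degree can only use the leading monomial of `b`
    have hδb : δ = m.degree (b : MvPolynomial ι K) := by
      by_contra hne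
      have := h b b.2 δ hδ hne
      rw [map_add] at hbound
      linarith
    exact ⟨b, b.2, hG0 b b.2, hδb ▸ le_add_self⟩
  · rw [← hG.leadIdeal_eq]
    refine Ideal.span_le.2 ?_
    rintro _ ⟨g, hg, rfl⟩
    refine Ideal.subset_span ⟨g, hG.subset hg, ?_⟩
    ext α
    rw [coeff_initialForm, MonomialOrder.leadingTerm, coeff_monomial]
    rcases eq_or_ne α (m.degree g) with rfl | hne
    · rw [if_pos (hle g hg), if_pos rfl, MonomialOrder.leadingCoeff]
    · rw [if_neg hne.symm, ite_eq_right_iff]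
      intro hmax
      by_contra hα
      exact absurd (hmax _ (m.degree_mem_support (hG0 g hg)))
        (not_le.2 (h g hg α (mem_support_iff.2 hα) hne))

/-- Conversely, if the weight vector and the order have the same initial ideal, then the leading
monomials of the *reduced* Gröbner basis are strictly maximal for the weight: no other monomial
of a basis element lies in the leading ideal. -/
theorem IsReducedGroebnerBasis.wdeg_lt_of_initialIdeal_eq (hG : IsReducedGroebnerBasis m I G)
    {ω : ι → ℝ} (h : initialIdeal ω I = leadIdeal m (I : Set (MvPolynomial ι K)))
    {g : MvPolynomial ι K} (hg : g ∈ G) {β : ι →₀ ℕ} (hβ : β ∈ g.support)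
    (hne : β ≠ m.degree g) : wdeg ω β < wdeg ω (m.degree g) := by
  have hkey : ∀ α ∈ g.support, (∀ β ∈ g.support, wdeg ω β ≤ wdeg ω α) → α = m.degree g := by
    intro α hα hmax
    have hin : initialForm ω g ∈ leadIdeal m G := by
      rw [hG.leadIdeal_eq, ← h]
      exact Ideal.subset_span ⟨g, hG.subset hg, rfl⟩
    obtain ⟨k, hk, -, hle⟩ := mem_leadIdeal_iff.1 hin α (mem_support_initialForm.2 ⟨hα, hmax⟩)
    obtain ⟨rfl, he⟩ := hG.eq_of_degree_le hk hg hα hle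
    exact he
  obtain ⟨α, hα, hmax⟩ := g.support.exists_max_image (wdeg ω) ⟨β, hβ⟩
  have hαg := hkey α hα hmax
  rw [← hαg]
  refine lt_of_le_of_ne (hmax β hβ) fun he => hne ?_
  exact hkey β hβ fun δ hδ => he ▸ hmax δ hδ

end Groebner

/-! ### Weight vectors representing a monomial order on finitely many comparisons -/

section Weights

variable {ι : Type} [Finite ι]

theorem wdeg_add_smul (ω ω' : ι → ℝ) (a b : ℝ) (α : ι →₀ ℕ) :
    wdeg (a • ω + b • ω') α = a * wdeg ω α + b * wdeg ω' α := by
  have := Fintype.ofFinite ι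
  simp only [wdeg_apply, Pi.add_apply, Pi.smul_apply, smul_eq_mul, Finset.mul_sum,
    ← Finset.sum_add_distrib]
  exact Finset.sum_congr rfl fun i _ => by ring

theorem wdeg_add_single [DecidableEq ι] (ω : ι → ℝ) (i : ι) (c : ℝ) (α : ι →₀ ℕ) :
    wdeg (ω + Pi.single i c) α = wdeg ω α + c * α i := by
  have := Fintype.ofFinite ι
  simp [wdeg_apply, add_mul, Finset.sum_add_distrib, Pi.single_apply]

/-- Fourier–Motzkin elimination of the variables in `S`. When `i` is eliminated, a comparison in
which the exponent of `i` grows and one in which it drops are combined, with positive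
multiplicities, to a comparison in which it is constant; the value of the weight at `i` then only has to lie between
finitely many lower and finitely many larger upper bounds. -/
theorem exists_wdeg_lt_of_agree_off (m : MonomialOrder.{0, v} ι) (S : Finset ι) :
    ∀ V : Finset ((ι →₀ ℕ) × (ι →₀ ℕ)), (∀ p ∈ V, m.toSyn p.1 < m.toSyn p.2) →
      (∀ p ∈ V, ∀ i ∉ S, p.1 i = p.2 i) → ∃ ω : ι → ℝ, ∀ p ∈ V, wdeg ω p.1 < wdeg ω p.2 := by
  classical
  induction S using Finset.induction_on with
  | empty =>
    intro V hV hS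
    refine ⟨0, fun p hp => absurd (hV p hp) ?_⟩
    rw [Finsupp.ext fun i => hS p hp i (Finset.notMem_empty i)]
    exact lt_irrefl _
  | insert i S hi ih =>
    intro V hV hS
    set U := V.filter fun p => p.1 i < p.2 i with hU
    set D := V.filter fun p => p.2 i < p.1 i with hD
    set comb : ((ι →₀ ℕ) × (ι →₀ ℕ)) × ((ι →₀ ℕ) × (ι →₀ ℕ)) → (ι →₀ ℕ) × (ι →₀ ℕ) :=
      fun x => (x.2.1 i - x.2.2 i) • x.1 + (x.1.2 i - x.1.1 i) • x.2 with hcomb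
    obtain ⟨ω, hω⟩ := ih (V.filter (fun p => p.1 i = p.2 i) ∪ (U ×ˢ D).image comb) (by
      intro p hp
      rcases Finset.mem_union.1 hp with hp | hp
      · exact hV p (Finset.mem_filter.1 hp).1
      · obtain ⟨⟨p, q⟩, hpq, rfl⟩ := Finset.mem_image.1 hp
        obtain ⟨hp, hq⟩ := Finset.mem_product.1 hpq
        obtain ⟨hpV, hpi⟩ := Finset.mem_filter.1 hp
        obtain ⟨hqV, hqi⟩ := Finset.mem_filter.1 hq
        simp only [hcomb, Prod.fst_add, Prod.snd_add, Prod.smul_fst, Prod.smul_snd, map_add,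
          map_nsmul]
        exact add_lt_add (nsmul_lt_nsmul_right (Nat.sub_pos_of_lt hqi).ne' (hV p hpV))
          (nsmul_lt_nsmul_right (Nat.sub_pos_of_lt hpi).ne' (hV q hqV))) (by
      intro p hp j hj
      rcases Finset.mem_union.1 hp with hp | hp
      · obtain ⟨hpV, hpi⟩ := Finset.mem_filter.1 hp
        rcases eq_or_ne j i with rfl | hji
        · exact hpi
        · exact hS p hpV j (by simp [hji, hj])
      · obtain ⟨⟨p, q⟩, hpq, rfl⟩ := Finset.mem_image.1 hp
        obtain ⟨hp, hq⟩ := Finset.mem_product.1 hpq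
        obtain ⟨hpV, hpi⟩ := Finset.mem_filter.1 hp
        obtain ⟨hqV, hqi⟩ := Finset.mem_filter.1 hq
        simp only [hcomb, Prod.fst_add, Prod.snd_add, Prod.smul_fst, Prod.smul_snd,
          Finsupp.add_apply, Finsupp.smul_apply, smul_eq_mul]
        rcases eq_or_ne j i with rfl | hji
        · have hpi : p.1 j < p.2 j := hpi
          have hqi : q.2 j < q.1 j := hqi
          obtain ⟨a, ha⟩ := Nat.exists_eq_add_of_lt hpi
          obtain ⟨b, hb⟩ := Nat.exists_eq_add_of_lt hqi
          have h1 : p.2 j - p.1 j = a + 1 := by omega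
          have h2 : q.1 j - q.2 j = b + 1 := by omega
          rw [h1, h2, ha, hb]
          ring
        · rw [hS p hpV j (by simp [hji, hj]), hS q hqV j (by simp [hji, hj])])
    have hpos : ∀ p ∈ U, (0 : ℝ) < p.2 i - p.1 i := fun p hp => by
      have := (Finset.mem_filter.1 hp).2
      exact sub_pos.2 (by exact_mod_cast this)
    have hneg : ∀ q ∈ D, (0 : ℝ) < q.1 i - q.2 i := fun q hq => by
      have := (Finset.mem_filter.1 hq).2
      exact sub_pos.2 (by exact_mod_cast this)
    obtain ⟨c, hlo, hhi⟩ := Order.exists_between_finsets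
      (U.image fun p => (wdeg ω p.1 - wdeg ω p.2) / (p.2 i - p.1 i : ℝ))
      (D.image fun q => (wdeg ω q.2 - wdeg ω q.1) / (q.1 i - q.2 i : ℝ)) (by
        intro x hx y hy
        obtain ⟨p, hp, rfl⟩ := Finset.mem_image.1 hx
        obtain ⟨q, hq, rfl⟩ := Finset.mem_image.1 hy
        have h := hω (comb (p, q)) (Finset.mem_union_right _
          (Finset.mem_image_of_mem _ (Finset.mk_mem_product hp hq)))
        simp only [hcomb, Prod.fst_add, Prod.snd_add, Prod.smul_fst, Prod.smul_snd, map_add,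
          map_nsmul, nsmul_eq_mul, Nat.cast_sub (Finset.mem_filter.1 hp).2.le,
          Nat.cast_sub (Finset.mem_filter.1 hq).2.le] at h
        rw [div_lt_div_iff₀ (hpos p hp) (hneg q hq)]
        linarith)
    refine ⟨ω + Pi.single i c, fun p hp => ?_⟩
    rw [wdeg_add_single, wdeg_add_single]
    rcases lt_trichotomy (p.1 i) (p.2 i) with h | h | h
    · have hpU : p ∈ U := Finset.mem_filter.2 ⟨hp, h⟩
      have := hlo _ (Finset.mem_image_of_mem _ hpU)
      rw [div_lt_iff₀ (hpos p hpU)] at this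
      linarith
    · rw [h]
      exact add_lt_add_left (hω p (Finset.mem_union_left _ (Finset.mem_filter.2 ⟨hp, h⟩))) _
    · have hpD : p ∈ D := Finset.mem_filter.2 ⟨hp, h⟩
      have := hhi _ (Finset.mem_image_of_mem _ hpD)
      rw [lt_div_iff₀ (hneg p hpD)] at this
      linarith

/-- Finitely many comparisons of a monomial order are represented by a nonnegative weight vector. -/
theorem exists_nonneg_wdeg_lt (m : MonomialOrder.{0, v} ι)
    (V : Finset ((ι →₀ ℕ) × (ι →₀ ℕ))) (hV : ∀ p ∈ V, m.toSyn p.1 < m.toSyn p.2) :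
    ∃ ω : ι → ℝ, 0 ≤ ω ∧ ∀ p ∈ V, wdeg ω p.1 < wdeg ω p.2 := by
  classical
  have := Fintype.ofFinite ι
  -- the comparisons `1 ≺ y_i` enforce nonnegativity
  obtain ⟨ω, hω⟩ := exists_wdeg_lt_of_agree_off m Finset.univ
    (V ∪ Finset.univ.image fun i => (0, Finsupp.single i 1)) (by
      intro p hp
      rcases Finset.mem_union.1 hp with hp | hp
      · exact hV p hp
      · obtain ⟨i, -, rfl⟩ := Finset.mem_image.1 hp
        refine lt_of_le_of_ne (m.toSyn_monotone zero_le) fun h => ?_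
        have := DFunLike.congr_fun (m.toSyn.injective h) i
        simp at this) (fun p _ i hi => absurd (Finset.mem_univ i) hi)
  refine ⟨ω, fun i => ?_, fun p hp => hω p (Finset.mem_union_left _ hp)⟩
  have := hω (0, Finsupp.single i 1)
    (Finset.mem_union_right _ (Finset.mem_image_of_mem _ (Finset.mem_univ i)))
  simpa [wdeg, Finsupp.weight_single] using this.le

end Weights

/-! ### Gröbner cones -/

section Cone

variable {ι : Type} {K : Type u} [Field K] {m : MonomialOrder.{0, v} ι}
  {I : Ideal (MvPolynomial ι K)} {G : Set (MvPolynomial ι K)}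

theorem Refines.wdeg_le {ω : ι → ℝ} (hm : Refines m ω) {α β : ι →₀ ℕ}
    (h : m.toSyn α ≤ m.toSyn β) : wdeg ω α ≤ wdeg ω β := by
  by_contra! hlt
  exact absurd (hm _ _ hlt) (not_lt.2 h)

theorem groebnerCone_congr {m' : MonomialOrder.{0, v} ι}
    (h : leadIdeal m' (I : Set (MvPolynomial ι K)) = leadIdeal m (I : Set (MvPolynomial ι K))) :
    groebnerCone m' I = groebnerCone m I := by
  rw [groebnerCone, groebnerCone, h]

variable [Finite ι]

theorem IsReducedGroebnerBasis.setOf_initialIdeal_eq (hG : IsReducedGroebnerBasis m I G) :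
    {ω | 0 ≤ ω ∧ initialIdeal ω I = leadIdeal m (I : Set (MvPolynomial ι K))} =
      {ω | 0 ≤ ω ∧ ∀ g ∈ G, ∀ β ∈ g.support, β ≠ m.degree g →
        wdeg ω β < wdeg ω (m.degree g)} := by
  ext ω
  refine and_congr_right fun hω => ⟨fun h g hg β hβ hne => ?_, fun h => ?_⟩
  · exact hG.wdeg_lt_of_initialIdeal_eq h hg hβ hne
  · exact hG.toIsGroebnerBasis.initialIdeal_eq (fun g hg => hG.ne_zero hg) hω h

theorem convex_groebnerCone (m : MonomialOrder.{0, v} ι) (I : Ideal (MvPolynomial ι K)) :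
    Convex ℝ (groebnerCone m I) := by
  obtain ⟨G, hG⟩ := exists_isReducedGroebnerBasis m I
  refine Convex.closure ?_
  rw [hG.setOf_initialIdeal_eq]
  intro ω ⟨hω, h⟩ ω' ⟨hω', h'⟩ a b ha hb hab
  refine ⟨add_nonneg (smul_nonneg ha hω) (smul_nonneg hb hω'), fun g hg β hβ hne => ?_⟩
  rw [wdeg_add_smul, wdeg_add_smul]
  have h1 := h g hg β hβ hne
  have h2 := h' g hg β hβ hne
  rcases ha.eq_or_lt with rfl | ha
  · obtain rfl : b = 1 := by linarith
    linarith
  · exact add_lt_add_of_lt_of_le (mul_lt_mul_of_pos_left h1 ha)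
      (mul_le_mul_of_nonneg_left h2.le hb)

/-- The Gröbner cone contains all weight vectors for which the leading monomials of the reduced
Gröbner basis are weakly maximal: they are limits of vectors for which these are strictly
maximal. -/
theorem IsReducedGroebnerBasis.mem_groebnerCone (hG : IsReducedGroebnerBasis m I G) {ω : ι → ℝ}
    (hω : 0 ≤ ω) (h : ∀ g ∈ G, ∀ β ∈ g.support, wdeg ω β ≤ wdeg ω (m.degree g)) :
    ω ∈ groebnerCone m I := by
  classical
  obtain ⟨ω₀, hω₀, hlt⟩ := exists_nonneg_wdeg_lt m
    (hG.finite.toFinset.biUnion fun g =>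
      (g.support.erase (m.degree g)).image fun β => (β, m.degree g)) (by
      intro p hp
      simp only [Finset.mem_biUnion, Finset.mem_image, Finset.mem_erase] at hp
      obtain ⟨g, -, β, ⟨hne, hβ⟩, rfl⟩ := hp
      exact lt_of_le_of_ne (m.le_degree hβ) fun h => hne (m.toSyn.injective h))
  have hlt' : ∀ g ∈ G, ∀ β ∈ g.support, β ≠ m.degree g → wdeg ω₀ β < wdeg ω₀ (m.degree g) := by
    intro g hg β hβ hne
    refine hlt (β, m.degree g) ?_
    simp only [Finset.mem_biUnion, Finset.mem_image, Finset.mem_erase]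
    exact ⟨g, hG.finite.mem_toFinset.2 hg, β, ⟨hne, hβ⟩, rfl⟩
  rw [groebnerCone, hG.setOf_initialIdeal_eq]
  have htend : Filter.Tendsto (fun ε : ℝ => (1 : ℝ) • ω + ε • ω₀) (nhdsWithin 0 (Set.Ioi 0))
      (nhds ω) := by
    have hc : Continuous fun ε : ℝ => (1 : ℝ) • ω + ε • ω₀ := by fun_prop
    have := hc.tendsto 0
    simp only [zero_smul, add_zero, one_smul] at this
    simpa using this.mono_left nhdsWithin_le_nhds
  refine mem_closure_of_tendsto htend ?_
  filter_upwards [self_mem_nhdsWithin] with ε hε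
  have hε' : (0 : ℝ) < ε := hε
  refine ⟨add_nonneg (smul_nonneg zero_le_one hω) (smul_nonneg hε'.le hω₀),
    fun g hg β hβ hne => ?_⟩
  rw [wdeg_add_smul, wdeg_add_smul]
  exact add_lt_add_of_le_of_lt (mul_le_mul_of_nonneg_left (h g hg β hβ) zero_le_one)
    (mul_lt_mul_of_pos_left (hlt' g hg β hβ hne) hε')

theorem Refines.mem_groebnerCone {ω : ι → ℝ} (hm : Refines m ω) (hω : 0 ≤ ω)
    (I : Ideal (MvPolynomial ι K)) : ω ∈ groebnerCone m I := by
  obtain ⟨G, hG⟩ := exists_isReducedGroebnerBasis m I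
  exact hG.mem_groebnerCone hω fun g _ β hβ => hm.wdeg_le (m.le_degree hβ)

theorem refines_weightOrder {ω : ι → ℝ} (hω : 0 ≤ ω) (m : MonomialOrder.{0, v} ι) :
    Refines (weightOrder ω hω m) ω :=
  fun α β h => (weightOrder_lt_iff ω hω m α β).2 (Or.inl h)

end Cone

/-! ### The walk along the segment towards `τ` -/

section Walk

/-- The part of a segment that lies in a closed convex set containing its starting point is a
segment. -/
theorem exists_segment_eq_inter {E : Type*} [AddCommGroup E] [Module ℝ E] [TopologicalSpace E]
    [IsTopologicalAddGroup E] [ContinuousSMul ℝ E] {C : Set E} (hC : Convex ℝ C)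
    (hcl : IsClosed C) {a : E} (ha : a ∈ C) (b : E) :
    ∃ w, segment ℝ a w = segment ℝ a b ∩ C := by
  set f : ℝ →ᵃ[ℝ] E := AffineMap.lineMap a b with hf
  have hcont : Continuous f := AffineMap.lineMap_continuous
  have hf0 : f 0 = a := AffineMap.lineMap_apply_zero a b
  have hcpt : IsCompact (Set.Icc (0 : ℝ) 1 ∩ f ⁻¹' C) :=
    isCompact_Icc.inter_right (hcl.preimage hcont)
  obtain ⟨t, ⟨ht, htC⟩, hmax⟩ := hcpt.exists_isGreatest
    ⟨0, ⟨le_rfl, zero_le_one⟩, by rwa [Set.mem_preimage, hf0]⟩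
  refine ⟨f t, Set.Subset.antisymm ?_ ?_⟩
  · refine ((convex_segment a b).inter hC).segment_subset ⟨left_mem_segment ℝ a b, ha⟩ ⟨?_, htC⟩
    rw [segment_eq_image_lineMap]
    exact ⟨t, ht, rfl⟩
  · rintro x ⟨hx, hxC⟩
    rw [segment_eq_image_lineMap] at hx
    obtain ⟨s, hs, rfl⟩ := hx
    have himage : segment ℝ a (f t) = f '' Set.Icc 0 t := by
      rw [← segment_eq_Icc ht.1, image_segment, hf0]
    rw [himage]
    exact ⟨s, ⟨hs.1, hmax ⟨hs, hxC⟩⟩, rfl⟩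

variable {ι : Type} [Finite ι] {K : Type u} [Field K] {m : MonomialOrder.{0, v} ι}
  {I : Ideal (MvPolynomial ι K)}

/-- If `≺` refines `τ`, then the Gröbner cone of `(ω | ≺)` contains an initial part of the segment
from `ω` to `τ`. -/
theorem exists_mem_groebnerCone_weightOrder {τ ω : ι → ℝ} (hm : Refines m τ) (hτ : 0 ≤ τ)
    (hω : 0 ≤ ω) (I : Ideal (MvPolynomial ι K)) :
    ∃ ε : ℝ, 0 < ε ∧ ε ≤ 1 ∧
      (1 - ε) • ω + ε • τ ∈ groebnerCone (weightOrder ω hω m) I := by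
  obtain ⟨G, hG⟩ := exists_isReducedGroebnerBasis (weightOrder ω hω m) I
  have hev : ∀ᶠ ε : ℝ in nhdsWithin 0 (Set.Ioi 0), ∀ g ∈ G, ∀ β ∈ g.support,
      wdeg ((1 - ε) • ω + ε • τ) β ≤
        wdeg ((1 - ε) • ω + ε • τ) ((weightOrder ω hω m).degree g) := by
    refine (Filter.eventually_all_finite hG.finite).2 fun g hg =>
      (Filter.eventually_all_finset g.support).2 fun β hβ => ?_
    simp only [wdeg_add_smul]
    set α := (weightOrder ω hω m).degree g
    have hle := (weightOrder ω hω m).le_degree hβ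
    rcases (wdeg_le_of_toSyn_le hle).lt_or_eq with hlt | heq
    · have hc : ∀ δ : ι →₀ ℕ, Filter.Tendsto (fun ε : ℝ => (1 - ε) * wdeg ω δ + ε * wdeg τ δ)
          (nhdsWithin 0 (Set.Ioi 0)) (nhds (wdeg ω δ)) := fun δ => by
        have hc' : Continuous fun ε : ℝ => (1 - ε) * wdeg ω δ + ε * wdeg τ δ := by fun_prop
        have := hc'.tendsto 0
        simp only [sub_zero, one_mul, zero_mul, add_zero] at this
        exact this.mono_left nhdsWithin_le_nhds
      exact ((hc β).eventually_lt (hc α) hlt).mono fun _ h => h.le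
    · have hτle : wdeg τ β ≤ wdeg τ α := by
        refine hm.wdeg_le (not_lt.1 fun h => absurd hle (not_le.2 ?_))
        exact (weightOrder_lt_iff ω hω m _ _).2 (Or.inr ⟨heq.symm, h⟩)
      filter_upwards [self_mem_nhdsWithin] with ε hε
      rw [heq]
      have hε' : (0 : ℝ) < ε := hε
      gcongr
  have h1 : ∀ᶠ ε : ℝ in nhdsWithin 0 (Set.Ioi 0), ε ≤ 1 :=
    (Filter.Eventually.filter_mono nhdsWithin_le_nhds (eventually_le_nhds zero_lt_one))
  obtain ⟨ε, hG', hε1, hε0⟩ := (hev.and (h1.and self_mem_nhdsWithin)).exists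
  have hε : (0 : ℝ) < ε := hε0
  refine ⟨ε, hε, hε1, hG.mem_groebnerCone ?_ hG'⟩
  exact add_nonneg (smul_nonneg (sub_nonneg.2 hε1) hω) (smul_nonneg hε.le hτ)

/-- As `u` decreases to `u' < 1`, the orders `(uσ + (1-u)τ | ≺)` agree eventually, in each single
comparison, with the order that compares first the weights `u'σ + (1-u')τ`, then the weights `σ`,
and then uses `≺`. -/
theorem eventually_weightOrder_lt {σ τ : ι → ℝ} (hσ : 0 ≤ σ)
    {u : ℕ → ℝ} {u' : ℝ} (hu : Filter.Tendsto u Filter.atTop (nhds u')) (hlt : ∀ k, u' < u k)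
    (h1 : u' < 1) (ω : ℕ → ι → ℝ) (hω : ∀ k, 0 ≤ ω k)
    (hωu : ∀ k, ω k = u k • σ + (1 - u k) • τ) (hω' : 0 ≤ u' • σ + (1 - u') • τ)
    {α β : ι →₀ ℕ}
    (h : (weightOrder _ hω' (weightOrder σ hσ m)).toSyn β <
      (weightOrder _ hω' (weightOrder σ hσ m)).toSyn α) :
    ∀ᶠ k in Filter.atTop, (weightOrder (ω k) (hω k) m).toSyn β <
      (weightOrder (ω k) (hω k) m).toSyn α := by
  simp only [weightOrder_lt_iff, hωu, wdeg_add_smul] at h ⊢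
  rcases h with h | ⟨heq, h⟩
  · have hc : ∀ δ : ι →₀ ℕ, Filter.Tendsto (fun k => u k * wdeg σ δ + (1 - u k) * wdeg τ δ)
        Filter.atTop (nhds (u' * wdeg σ δ + (1 - u') * wdeg τ δ)) := fun δ =>
      (hu.mul_const _).add ((hu.const_sub 1).mul_const _)
    exact ((hc β).eventually_lt (hc α) h).mono fun _ h => Or.inl h
  · refine Filter.Eventually.of_forall fun k => ?_
    -- both weighted degrees are affine in `u` and agree at `u'`
    have hid : (1 - u') * ((u k * wdeg σ α + (1 - u k) * wdeg τ α) -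
        (u k * wdeg σ β + (1 - u k) * wdeg τ β)) = (u k - u') * (wdeg σ α - wdeg σ β) := by
      linear_combination (-(1 - u k)) * heq
    have h1' : 0 < 1 - u' := sub_pos.2 h1
    rcases h with h | ⟨hσeq, h⟩
    · left
      have hpos : 0 < (u k - u') * (wdeg σ α - wdeg σ β) :=
        mul_pos (sub_pos.2 (hlt k)) (sub_pos.2 h)
      rw [← hid] at hpos
      exact sub_pos.1 (pos_of_mul_pos_right hpos h1'.le)
    · right
      refine ⟨?_, h⟩
      rw [hσeq, sub_self, mul_zero] at hid
      rw [hσeq]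
      exact (sub_eq_zero.1 ((mul_eq_zero.1 hid).resolve_left h1'.ne')).symm

/-- A sequence of points that move towards `τ` without stopping is given by parameters which
strictly decrease. -/
theorem exists_strictAnti_parameter {E : Type*} [AddCommGroup E] [Module ℝ E] {τ : E} {ω : ℕ → E}
    (hseg : ∀ k, ω (k + 1) ∈ segment ℝ (ω k) τ) (hne : ∀ k, ω k ≠ τ)
    (hmove : ∀ k, ω (k + 1) ≠ ω k) :
    ∃ u : ℕ → ℝ, StrictAnti u ∧ u 0 = 1 ∧ (∀ k, 0 < u k) ∧
      ∀ k, ω k = u k • ω 0 + (1 - u k) • τ := by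
  have hstep : ∀ k, ∃ c : ℝ, 0 < c ∧ c < 1 ∧ ω (k + 1) = c • ω k + (1 - c) • τ := by
    intro k
    obtain ⟨a, b, ha, hb, hab, he⟩ := hseg k
    obtain rfl : b = 1 - a := by linarith
    refine ⟨a, lt_of_le_of_ne ha ?_, lt_of_le_of_ne (by linarith) ?_, he.symm⟩
    · rintro rfl
      exact hne (k + 1) (by rw [← he]; simp)
    · rintro rfl
      exact hmove k (by rw [← he]; simp)
  choose c hc0 hc1 hc using hstep
  have hpos : ∀ k, 0 < ∏ i ∈ Finset.range k, c i := fun k => Finset.prod_pos fun i _ => hc0 i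
  refine ⟨fun k => ∏ i ∈ Finset.range k, c i, strictAnti_nat_of_succ_lt fun k => ?_, by simp,
    hpos, fun k => ?_⟩
  · rw [Finset.prod_range_succ]
    exact mul_lt_of_lt_one_right (hpos k) (hc1 k)
  · induction k with
    | zero => simp
    | succ k ih =>
      simp only at ih ⊢
      rw [hc k, ih, Finset.prod_range_succ]
      module

/-- The walk reaches `τ`. Otherwise its points converge to some point of the segment, and the orders
belonging to points close to the limit all have the same leading ideal, namely that of the order
which first compares the weights of the limit and then those of the starting point. So they have
the same Gröbner cone, and the walk would have had to cross it in one step. -/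
theorem exists_walk_eq_target {τ : ι → ℝ} (hm : Refines m τ) (hτ : 0 ≤ τ) (ω : ℕ → ι → ℝ)
    (hω : ∀ k, 0 ≤ ω k)
    (hseg : ∀ k, segment ℝ (ω k) (ω (k + 1)) =
      segment ℝ (ω k) τ ∩ groebnerCone (weightOrder (ω k) (hω k) m) I) :
    ∃ k, ω k = τ := by
  by_contra! hne
  have hmem : ∀ k, ω (k + 1) ∈ segment ℝ (ω k) τ ∩ groebnerCone (weightOrder (ω k) (hω k) m) I :=
    fun k => hseg k ▸ right_mem_segment ℝ _ _
  have hmove : ∀ k, ω (k + 1) ≠ ω k := fun k he => by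
    obtain ⟨ε, hε0, hε1, hε⟩ := exists_mem_groebnerCone_weightOrder hm hτ (hω k) I
    have hin : (1 - ε) • ω k + ε • τ ∈ segment ℝ (ω k) (ω (k + 1)) := by
      rw [hseg k]
      exact ⟨⟨1 - ε, ε, sub_nonneg.2 hε1, hε0.le, by ring, rfl⟩, hε⟩
    rw [he, segment_same, Set.mem_singleton_iff] at hin
    have h0 : ε • (τ - ω k) = 0 := by
      rw [← sub_eq_zero] at hin
      rw [← hin]
      module
    exact hne k (sub_eq_zero.1 ((smul_eq_zero.1 h0).resolve_left hε0.ne')).symm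
  obtain ⟨u, hanti, hu0, hupos, hωu⟩ := exists_strictAnti_parameter (fun k => (hmem k).1) hne hmove
  have hbdd : BddBelow (Set.range u) := ⟨0, by rintro _ ⟨k, rfl⟩; exact (hupos k).le⟩
  have htend := tendsto_atTop_ciInf hanti.antitone hbdd
  set u' := ⨅ k, u k
  have hlt : ∀ k, u' < u k := fun k => (ciInf_le hbdd (k + 1)).trans_lt (hanti k.lt_succ_self)
  have hu'0 : 0 ≤ u' := le_ciInf fun k => (hupos k).le
  have hu'1 : u' < 1 := hu0 ▸ hlt 0
  have hω' : 0 ≤ u' • ω 0 + (1 - u') • τ :=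
    add_nonneg (smul_nonneg hu'0 (hω 0)) (smul_nonneg (sub_nonneg.2 hu'1.le) hτ)
  obtain ⟨G, hG⟩ := exists_isReducedGroebnerBasis (weightOrder _ hω' (weightOrder _ (hω 0) m)) I
  have hev : ∀ᶠ k in Filter.atTop, ∀ g ∈ G, ∀ β ∈ g.support,
      β ≠ (weightOrder _ hω' (weightOrder _ (hω 0) m)).degree g →
      (weightOrder (ω k) (hω k) m).toSyn β < (weightOrder (ω k) (hω k) m).toSyn
        ((weightOrder _ hω' (weightOrder _ (hω 0) m)).degree g) := by
    refine (Filter.eventually_all_finite hG.finite).2 fun g hg =>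
      (Filter.eventually_all_finset g.support).2 fun β hβ =>
      Filter.eventually_imp_distrib_left.2 fun hβne => ?_
    refine eventually_weightOrder_lt (hω 0) htend hlt hu'1 ω hω hωu hω' ?_
    exact lt_of_le_of_ne (MonomialOrder.le_degree hβ) fun h => hβne (Equiv.injective _ h)
  obtain ⟨N, hN⟩ := Filter.eventually_atTop.1 hev
  have hcone : ∀ k ≥ N, groebnerCone (weightOrder (ω k) (hω k) m) I =
      groebnerCone (weightOrder _ hω' (weightOrder _ (hω 0) m)) I := fun k hk =>
    groebnerCone_congr <| hG.leadIdeal_eq_of_degree_eq (fun g hg => hG.ne_zero hg) fun g hg =>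
      degree_eq_of_forall_lt (hG.ne_zero hg) (MonomialOrder.degree_mem_support (hG.ne_zero hg))
        (hN k hk g hg)
  have hmem2 : ω (N + 2) ∈ segment ℝ (ω N) (ω (N + 1)) := by
    rw [hseg N]
    refine ⟨?_, ?_⟩
    · exact (convex_segment (ω N) τ).segment_subset (hmem N).1 (right_mem_segment ℝ _ _)
        (hmem (N + 1)).1
    · rw [hcone N le_rfl, ← hcone (N + 1) (Nat.le_succ N)]
      exact (hmem (N + 1)).2
  obtain ⟨a, b, ha, hb, hab, he⟩ := hmem2
  have h0 : (a * u N + b * u (N + 1) - u (N + 2)) • (ω 0 - τ) = 0 := by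
    rw [← sub_eq_zero, hωu N, hωu (N + 1), hωu (N + 2)] at he
    rw [← he]
    obtain rfl : a = 1 - b := by linarith
    module
  have h1 := (smul_eq_zero.1 h0).resolve_right (sub_ne_zero.2 (hne 0))
  have h2 : u (N + 1) < u N := hanti N.lt_succ_self
  have h3 : u (N + 2) < u (N + 1) := hanti (N + 1).lt_succ_self
  obtain rfl : a = 1 - b := by linarith
  have h4 := mul_nonneg ha (sub_nonneg.2 h2.le)
  linarith

end Walk

/-! ### Elimination -/

section Elimination

variable {K : Type u} [Field K] {n r : ℕ} {m : MonomialOrder.{0, v} (Fin n ⊕ Fin r)}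
  {I : Ideal (MvPolynomial (Fin n ⊕ Fin r) K)}

theorem embX_injective : Function.Injective (embX K n r) :=
  rename_injective _ Sum.inl_injective

theorem mem_range_embX_iff {p : MvPolynomial (Fin n ⊕ Fin r) K} :
    p ∈ (embX K n r).range ↔ ∀ α ∈ p.support, ∀ j, α (Sum.inr j) = 0 := by
  classical
  constructor
  · rintro ⟨q, rfl⟩ α hα j
    have hα' : α ∈ (rename Sum.inl q).support := hα
    rw [support_rename_of_injective Sum.inl_injective] at hα'
    obtain ⟨β, -, rfl⟩ := Finset.mem_image.1 hα'
    exact Finsupp.mapDomain_of_notMem_range _ _ (by simp)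
  · intro h
    obtain ⟨q, rfl⟩ := exists_rename_eq_of_vars_subset_range p (Sum.inl : Fin n → Fin n ⊕ Fin r)
      Sum.inl_injective (by
        rintro (i | j) hi
        · exact ⟨i, rfl⟩
        · obtain ⟨α, hα, hj⟩ := (mem_vars_iff_mem_support _).1 hi
          exact absurd (h α hα j) (Finsupp.mem_support_iff.1 hj))
    exact ⟨q, rfl⟩

theorem degree_embX (f : MvPolynomial (Fin n) K) :
    m.degree (embX K n r f) = ((restrictX m).degree f).mapDomain Sum.inl := by
  classical
  by_cases h0 : f = 0
  · simp [h0]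
  have hsupp : (embX K n r f).support = f.support.image (Finsupp.mapDomain Sum.inl) :=
    support_rename_of_injective Sum.inl_injective
  refine degree_eq_of_forall_lt ((map_ne_zero_iff _ embX_injective).2 h0) ?_ fun β hβ hne => ?_
  · rw [hsupp]
    exact Finset.mem_image_of_mem _ ((restrictX m).degree_mem_support h0)
  · rw [hsupp] at hβ
    obtain ⟨α, hα, rfl⟩ := Finset.mem_image.1 hβ
    refine (restrictX_lt_iff m _ _).1 (lt_of_le_of_ne ((restrictX m).le_degree hα) fun h => ?_)
    exact hne (by rw [(restrictX m).toSyn.injective h])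

theorem leadingCoeff_embX (f : MvPolynomial (Fin n) K) :
    m.leadingCoeff (embX K n r f) = (restrictX m).leadingCoeff f := by
  rw [MonomialOrder.leadingCoeff, degree_embX, MonomialOrder.leadingCoeff]
  exact coeff_rename_mapDomain _ Sum.inl_injective _ _

theorem mapDomain_inl_le_iff {α β : Fin n →₀ ℕ} :
    α.mapDomain (Sum.inl : Fin n → Fin n ⊕ Fin r) ≤ β.mapDomain Sum.inl ↔ α ≤ β := by
  refine ⟨fun h i => ?_, fun h => Finsupp.mapDomain_mono h⟩
  have := h (Sum.inl i)
  rwa [Finsupp.mapDomain_apply Sum.inl_injective, Finsupp.mapDomain_apply Sum.inl_injective] at this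

theorem leadingTerm_mem_range_embX_iff {g : MvPolynomial (Fin n ⊕ Fin r) K} (h0 : g ≠ 0) :
    m.leadingTerm g ∈ (embX K n r).range ↔ ∀ j, m.degree g (Sum.inr j) = 0 := by
  rw [mem_range_embX_iff, m.support_leadingTerm' h0]
  simp

/-- An order that refines a weight vector which is positive on `U` and zero on `X` is an elimination
order for every ideal. -/
theorem isElimOrder_of_refines {γ : Fin r → ℝ} (hγ : ∀ j, 0 < γ j)
    (hm : Refines m (Sum.elim (fun _ => 0) γ)) (I : Ideal (MvPolynomial (Fin n ⊕ Fin r) K)) :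
    IsElimOrder m I := by
  obtain ⟨G, hG⟩ := exists_isReducedGroebnerBasis m I
  refine ⟨G, hG, fun g hg hlt => mem_range_embX_iff.2 fun β hβ j => ?_⟩
  rw [leadingTerm_mem_range_embX_iff (hG.ne_zero hg)] at hlt
  have hle := hm.wdeg_le (m.le_degree hβ)
  simp only [wdeg_apply, Fintype.sum_sum_type, Sum.elim_inl, Sum.elim_inr, zero_mul,
    Finset.sum_const_zero, zero_add, hlt, Nat.cast_zero, mul_zero] at hle
  have hnonneg : ∀ i ∈ Finset.univ, 0 ≤ γ i * (β (Sum.inr i) : ℝ) := fun i _ =>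
    mul_nonneg (hγ i).le (Nat.cast_nonneg _)
  have h0 := (Finset.sum_eq_zero_iff_of_nonneg hnonneg).1
    (le_antisymm hle (Finset.sum_nonneg hnonneg)) j (Finset.mem_univ j)
  exact_mod_cast (mul_eq_zero.1 h0).resolve_left (hγ j).ne'

/-- If `≺` is an `I`-specific elimination order, then the elements in `K[X]` of the reduced Gröbner
basis of `I` form the reduced Gröbner basis of the elimination ideal: a leading monomial in `K[X]`
of an element of `I` is divisible only by leading monomials in `K[X]`. -/
theorem IsReducedGroebnerBasis.elimPart {G : Set (MvPolynomial (Fin n ⊕ Fin r) K)}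
    (hG : IsReducedGroebnerBasis m I G) (hm : IsElimOrder m I) :
    IsReducedGroebnerBasis (restrictX m) (elimIdeal I) (GroebnerWalk.elimPart G) := by
  classical
  obtain ⟨G', hG', helim⟩ := hm
  obtain rfl := hG.unique hG'
  have hsub : GroebnerWalk.elimPart G ⊆ (elimIdeal I : Set (MvPolynomial (Fin n) K)) :=
    fun g hg => hG.subset hg
  refine ⟨⟨hG.finite.preimage embX_injective.injOn, hsub, ?_⟩, fun g hg => ?_, ?_⟩
  · refine le_antisymm (leadIdeal_mono hsub) (leadIdeal_le_iff.2 fun f hf h0 => ?_)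
    obtain ⟨g, hg, hg0, hle⟩ := hG.exists_degree_le (f := embX K n r f) hf
      ((map_ne_zero_iff _ embX_injective).2 h0)
    rw [degree_embX] at hle
    obtain ⟨g', rfl⟩ := helim g hg ((leadingTerm_mem_range_embX_iff hg0).2 fun j => by
      have := hle (Sum.inr j)
      rw [Finsupp.mapDomain_of_notMem_range _ _ (by simp)] at this
      exact Nat.le_zero.1 this)
    have hdeg : m.degree ((embX K n r).toRingHom g') = _ := degree_embX g'
    rw [hdeg] at hle
    exact ⟨g', hg, fun h => hg0 (by simp [h]), mapDomain_inl_le_iff.1 hle⟩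
  · have := hG.normed _ hg
    rwa [MonomialOrder.Monic, leadingCoeff_embX] at this
  · intro g hg h hh hne α hα hle
    refine hG.reduced _ hg _ hh (fun he => hne (embX_injective he)) (α.mapDomain Sum.inl) ?_ ?_
    · have hsupp : (embX K n r h).support = h.support.image (Finsupp.mapDomain Sum.inl) :=
        support_rename_of_injective Sum.inl_injective
      rw [hsupp]
      exact Finset.mem_image_of_mem _ hα
    · rw [degree_embX]
      exact mapDomain_inl_le_iff.2 hle

end Elimination

/-! ### Invariants of the algorithm -/

section Algorithm

variable {K : Type u} [Field K] {n r : ℕ} {I : Ideal (MvPolynomial (Fin n ⊕ Fin r) K)}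
  {σ τ : Fin n ⊕ Fin r → ℝ} {ordσ ordτ : MonomialOrder.{0, v} (Fin n ⊕ Fin r)}
  {s t : State.{u, v} K n r}

theorem Step.mem_segment (h : Step I τ ordτ s t) : t.ω ∈ segment ℝ s.ω τ := by
  have := right_mem_segment ℝ s.ω t.ω
  rw [h.segment_eq] at this
  exact this.1

theorem Step.refines (h : Step I τ ordτ s t) : Refines t.order t.ω :=
  h.order_eq ▸ refines_weightOrder t.ω_nonneg ordτ

theorem Step.isReducedGroebnerBasis (h : Step I τ ordτ s t)
    (hs : IsReducedGroebnerBasis s.order I s.G) : IsReducedGroebnerBasis t.order I t.G := by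
  obtain ⟨H, hH, ht⟩ := h.basis
  rwa [hH.span_eq, hs.span_eq] at ht

theorem Reachable.invariant (hσ : Refines ordσ σ) (h : Reachable I σ τ ordσ ordτ s) :
    s.ω ∈ segment ℝ σ τ ∧ IsReducedGroebnerBasis s.order I s.G ∧ Refines s.order s.ω := by
  obtain ⟨s₀, h0, hs⟩ := h
  induction hs with
  | refl =>
    refine ⟨h0.ω_eq ▸ left_mem_segment ℝ _ _, h0.order_eq ▸ h0.basis, ?_⟩
    rw [h0.order_eq, h0.ω_eq]
    exact hσ
  | tail _ hstep ih =>
    exact ⟨(convex_segment σ τ).segment_subset ih.1 (right_mem_segment ℝ _ _) hstep.mem_segment,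
      hstep.isReducedGroebnerBasis ih.2.1, hstep.refines⟩

theorem exists_step (hτ : 0 ≤ τ) (hG : IsReducedGroebnerBasis s.order I s.G)
    (hs : Refines s.order s.ω) (hhalt : ¬ Halts I s) :
    ∃ t : State.{u, v} K n r, Step I τ ordτ s t := by
  obtain ⟨w, hw⟩ := exists_segment_eq_inter (convex_groebnerCone s.order I) isClosed_closure
    (hs.mem_groebnerCone s.ω_nonneg I) τ
  have hwseg : w ∈ segment ℝ s.ω τ := by
    have := right_mem_segment ℝ s.ω w
    rw [hw] at this
    exact this.1
  have hw0 : 0 ≤ w := (convex_Ici (𝕜 := ℝ) (0 : Fin n ⊕ Fin r → ℝ)).segment_subset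
    s.ω_nonneg hτ hwseg
  obtain ⟨G, hG'⟩ := exists_isReducedGroebnerBasis (weightOrder w hw0 ordτ) I
  refine ⟨⟨s.k + 1, w, hw0, weightOrder w hw0 ordτ, G⟩, hhalt, rfl, hw, rfl, G, ?_, ?_⟩
  · rw [hG.span_eq]
    exact hG'.toIsGroebnerBasis
  · rw [hG'.span_eq]
    exact hG'

end Algorithm

end GroebnerWalk

theorem theorem2 {K : Type u} [Field K] {n r : ℕ}
    (F : Finset (MvPolynomial (Fin n ⊕ Fin r) K))
    (σ : Fin n ⊕ Fin r → ℝ) (hσ : 0 ≤ σ)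
    (γ : Fin r → ℝ) (hγ : ∀ j, 0 < γ j)
    (τ : Fin n ⊕ Fin r → ℝ) (hτ : τ = Sum.elim (fun _ => 0) γ)
    (ordσ ordτ : MonomialOrder.{0, v} (Fin n ⊕ Fin r))
    (hordσ : GroebnerWalk.Refines ordσ σ) (hordτ : GroebnerWalk.Refines ordτ τ)
    (I : Ideal (MvPolynomial (Fin n ⊕ Fin r) K)) (hI : I = Ideal.span (F : Set _)) :
    -- the initialisation succeeds
    (∃ s : GroebnerWalk.State.{u, v} K n r, GroebnerWalk.IsInit I σ ordσ s) ∧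
    -- no execution gets stuck: if the termination test fails, the loop body can be carried out
    (∀ s : GroebnerWalk.State.{u, v} K n r, GroebnerWalk.Reachable I σ τ ordσ ordτ s →
      ¬ GroebnerWalk.Halts I s → ∃ t, GroebnerWalk.Step I τ ordτ s t) ∧
    -- no execution runs forever
    (¬ ∃ s : ℕ → GroebnerWalk.State.{u, v} K n r, GroebnerWalk.IsInit I σ ordσ (s 0) ∧
      ∀ k, GroebnerWalk.Step I τ ordτ (s k) (s (k + 1))) ∧
    -- throughout, `ω_k` lies on the segment and `G_k` is the reduced Gröbner basis for `≺_k`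
    (∀ s : GroebnerWalk.State.{u, v} K n r, GroebnerWalk.Reachable I σ τ ordσ ordτ s →
      s.ω ∈ segment ℝ σ τ ∧ GroebnerWalk.IsReducedGroebnerBasis s.order I s.G) ∧
    -- correctness of the output
    (∀ s : GroebnerWalk.State.{u, v} K n r, GroebnerWalk.Reachable I σ τ ordσ ordτ s →
      GroebnerWalk.Halts I s →
      GroebnerWalk.IsReducedGroebnerBasis (GroebnerWalk.restrictX s.order)
        (GroebnerWalk.elimIdeal I) (GroebnerWalk.elimPart s.G)) := by
  have hτ0 : 0 ≤ τ := by
    rw [hτ]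
    rintro (i | j)
    · exact le_rfl
    · exact (hγ j).le
  refine ⟨?_, fun s hs hhalt => ?_, ?_, fun s hs => ?_, fun s hs hhalt => ?_⟩
  · obtain ⟨G, hG⟩ := GroebnerWalk.exists_isReducedGroebnerBasis ordσ I
    exact ⟨⟨0, σ, hσ, ordσ, G⟩, rfl, rfl, rfl, hG⟩
  · obtain ⟨-, hG, href⟩ := hs.invariant hordσ
    exact GroebnerWalk.exists_step hτ0 hG href hhalt
  · rintro ⟨s, -, hstep⟩
    -- from the first step on, the order in use is `(ω_k | ≺_τ)`
    obtain ⟨k, hk⟩ := GroebnerWalk.exists_walk_eq_target (I := I) hordτ hτ0 (fun k => (s (k + 1)).ω)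
      (fun k => (s (k + 1)).ω_nonneg) fun k => by
        rw [← (hstep k).order_eq]
        exact (hstep (k + 1)).segment_eq
    refine (hstep (k + 1)).not_halts (GroebnerWalk.isElimOrder_of_refines hγ ?_ I)
    rw [← hτ, ← hk]
    exact (hstep k).refines
  · obtain ⟨hseg, hG, -⟩ := hs.invariant hordσ
    exact ⟨hseg, hG⟩
  · exact (hs.invariant hordσ).2.1.elimPart hhalt
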